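/- Graphs are finite and may have loops and multiple edges. A signed graph is a graph $G$ together with a signature $\sigma:E(G)\to\{1,-1\}$. Every edge $e$ consists of two half-edges, one at each of its ends (both at the same vertex if $e$ is a loop). For a half-edge $h$ let $e_h$ be the edge containing it and $\hat h$ the other half-edge of $e_h$, and for a vertex $v$ let $H_G(v)$ be the set of half-edges incident with $v$. An orientation of $(G,\sigma)$ is a map $\tau$ from the set of half-edges to $\{1,-1\}$ with $\tau(h)\tau(\hat h)=-\sigma(e_h)$ for every half-edge $h$. For an abelian group $A$, a nowhere-zero $A$-flow of $G$ under $\tau$ is a map $f:E(G)\to A\setminus\{0\}$ with $\sum_{h\in H_G(v)}\tau(h)f(e_h)=0$ for every vertex $v$; for a positive integer $k$, a nowhere-zero $k$-flow under $\tau$ is a nowhere-zero $\mathbb Z$-flow $f$ under $\tau$ with $|f(e)|<k$ for every edge $e$. The graph $G$ admits such a flow if it has one under some orientation. It is bridgeless if it has no cut-edge; it need not be connected. **Lemma.** Let $G$ be a bridgeless signed graph that admits a nowhere-zero $\mathbb Z_3$-flow. Then for every edge $e_0\in E(G)$, every $i\in\{1,2\}$ and every orientation $\tau$ of $G$, there is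 a nowhere-zero $3$-flow $f$ of $G$ under $\tau$ with $f(e_0)=i$. -/

import Mathlib

/-- A signed graph with vertex set `V` and edge set `E`; multiple edges and loops are allowed.
Every edge `e` is composed of the two half-edges `(e, false)` and `(e, true)`; the half-edge `h` is
incident with the vertex `G.endOf h` (a loop has both of its half-edges at the same vertex), and
`G.sign e` is the sign of the edge `e`. -/
structure SignedGraph (V E : Type*) where
  /-- the end of a half-edge -/
  endOf : E × Bool → V
  /-- the signature -/
  sign : E → ℤˣ

namespace SignedGraph

/-- The underlying (unsigned) multigraph. -/
def toGraph {V E : Type*} (G : SignedGraph V E) : Graph V E where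
  vertexSet := Set.univ
  edgeSet := Set.univ
  IsLink e x y := ∃ b : Bool, G.endOf (e, b) = x ∧ G.endOf (e, !b) = y
  isLink_symm := by
    intro e _
    refine ⟨?_⟩
    rintro x y ⟨b, hx, hy⟩
    exact ⟨!b, hy, by simpa using hx⟩
  eq_or_eq_of_isLink_of_isLink := by
    rintro e x y v w ⟨b, rfl, rfl⟩ ⟨c, rfl, rfl⟩
    cases b <;> cases c <;> simp
  edge_mem_iff_exists_isLink := fun e =>
    ⟨fun _ => ⟨_, _, false, rfl, rfl⟩, fun _ => Set.mem_univ e⟩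
  left_mem_of_isLink := fun _ x _ _ => Set.mem_univ x

/-- `e` is a cut-edge (bridge): its two ends lie in different components of `G - e`. -/
def IsCutEdge {V E : Type*} (G : SignedGraph V E) (e : E) : Prop :=
  ¬ Relation.ReflTransGen (G.toGraph.deleteEdges {e}).Adj (G.endOf (e, false)) (G.endOf (e, true))

/-- A signed graph is bridgeless if it has no cut-edge (it need not be connected). -/
def Bridgeless {V E : Type*} (G : SignedGraph V E) : Prop :=
  ∀ e : E, ¬ G.IsCutEdge e

/-- An orientation assigns `1` (away from the end) or `-1` (towards the end) to each half-edge so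
that the product over the two half-edges of an edge `e` is `- G.sign e`. -/
structure Orientation {V E : Type*} (G : SignedGraph V E) where
  /-- the direction of a half-edge -/
  dir : E × Bool → ℤˣ
  dir_mul_dir : ∀ e : E, dir (e, false) * dir (e, true) = - G.sign e

/-- Every signed graph has an orientation. -/
instance {V E : Type*} (G : SignedGraph V E) : Nonempty G.Orientation :=
  ⟨⟨fun h => if h.2 then - G.sign h.1 else 1, fun e => by simp⟩⟩

open Classical in
/-- The boundary of `f` at `v`: the sum of `τ(h) f(e_h)` over all half-edges `h` incident
with `v`. -/
noncomputable def boundary {V E A : Type*} [Fintype E] [AddCommGroup A] (G : SignedGraph V E)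
    (τ : G.Orientation) (f : E → A) (v : V) : A :=
  ∑ h : E × Bool with G.endOf h = v, (τ.dir h : ℤ) • f h.1

/-- `(τ, f)` is an `A`-flow of `G`. -/
def IsFlow {V E A : Type*} [Fintype E] [AddCommGroup A] (G : SignedGraph V E)
    (τ : G.Orientation) (f : E → A) : Prop :=
  ∀ v : V, G.boundary τ f v = 0

/-- `(τ, f)` is a nowhere-zero `A`-flow of `G`. -/
def IsNZF {V E A : Type*} [Fintype E] [AddCommGroup A] (G : SignedGraph V E)
    (τ : G.Orientation) (f : E → A) : Prop :=
  G.IsFlow τ f ∧ ∀ e : E, f e ≠ 0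

/-- `(τ, f)` is a nowhere-zero (integer) `k`-flow of `G`. -/
def IsIntNZF {V E : Type*} [Fintype E] (G : SignedGraph V E)
    (τ : G.Orientation) (k : ℕ) (f : E → ℤ) : Prop :=
  G.IsNZF τ f ∧ ∀ e : E, |f e| < (k : ℤ)

/-- `G` admits a nowhere-zero `A`-flow. -/
def AdmitsNZF {V E : Type*} [Fintype E] (G : SignedGraph V E) (A : Type*) [AddCommGroup A] : Prop :=
  ∃ (τ : G.Orientation) (f : E → A), G.IsNZF τ f

end SignedGraph

/-! Reversing edges turns the `ℤ₃`-flow into the constant `1`. Give a half-edge weight `b = 2` if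
outgoing and `b = 1` if incoming; then `b` is minus the direction modulo 3, so its sum at each
vertex `v` is `3 * n v`. It suffices to round `b / 3` to `c` with values 0 and 1, keeping the vertex
sums `n v`, with `c` complementary on positive edges and equal on negative ones: `3 * c - b` is then
the signed contribution of an integer flow with values `±1`, `±2`.

Such a `c` is read off a perfect matching of a gadget graph: `c h = 1` when the node of `h` is
matched to a core node of its vertex. The numbers `b / 3` give a positive fractional perfect
matching. Its odd cuts weigh at least 1 (`IsBalanced.one_le_cut`): a cut that splits no core set has
integral tripled weight, odd by parity, and the value 1 would force a bridge. Under these conditions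
Tutte's theorem puts any link into a perfect matching (`exists_matching_of_fractional`). The link
chosen at `e₀` fixes `|f e₀|`, and negating the flow fixes the sign. -/

section FractionalMatching

/-! ### Perfect matchings from fractional ones -/

variable {N L : Type*} [DecidableEq N] [Fintype L]

/-- A fractional perfect matching bounds the number of disjoint odd sets whose boundary links all
end in `W`; the bound is strict if `W` contains both ends of some link. -/
theorem card_odd_sets_lt_card {ι : Type*} [Fintype ι] (src tgt : L → N) (ω : L → ℚ)
    (hω : ∀ l, 0 < ω l)
    (hdeg : ∀ x, ∑ l, ((if src l = x then ω l else 0) + (if tgt l = x then ω l else 0)) = 1)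
    (hcut : ∀ C : Finset N, Odd C.card →
      1 ≤ ∑ l, if (src l ∈ C ↔ tgt l ∈ C) then 0 else ω l)
    (W : Finset N) (C : ι → Finset N) (hodd : ∀ i, Odd (C i).card)
    (hW : ∀ i, ∀ x ∈ C i, x ∉ W) (hdisj : ∀ i j x, x ∈ C i → x ∈ C j → i = j)
    (hst : ∀ i l, src l ∈ C i → tgt l ∈ C i ∨ tgt l ∈ W)
    (hts : ∀ i l, tgt l ∈ C i → src l ∈ C i ∨ src l ∈ W)
    (l₀ : L) (hs₀ : src l₀ ∈ W) (ht₀ : tgt l₀ ∈ W) :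
    Fintype.card ι < W.card := by
  classical
  have hsingle : ∀ (x : N) (w : ℚ), 0 ≤ w → ∑ i, (if x ∈ C i then w else 0) ≤ w := by
    intro x w hw
    by_cases h : ∃ i, x ∈ C i
    · obtain ⟨i, hi⟩ := h
      rw [Finset.sum_eq_single i]
      · simp [hi]
      · intro j _ hj
        rw [if_neg fun hj' => hj (hdisj j i x hj' hi)]
      · simp
    · push Not at h
      simp [h, hw]
  -- A link in the boundary of some `C i` has exactly one end in `W`, and by disjointness its other
  -- end lies in only one `C i`.
  have hle : ∀ l, ∑ i, (if (src l ∈ C i ↔ tgt l ∈ C i) then 0 else ω l) ≤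
      (if src l ∈ W then ω l else 0) + (if tgt l ∈ W then ω l else 0) := by
    intro l
    have hl := (hω l).le
    by_cases hs : src l ∈ W
    · have : ∀ i, src l ∉ C i := fun i hi => hW i _ hi hs
      have h1 := hsingle (tgt l) (ω l) hl
      simp only [this, false_iff, ite_not, hs, if_true]
      refine h1.trans ?_
      split_ifs <;> linarith
    · by_cases ht : tgt l ∈ W
      · have : ∀ i, tgt l ∉ C i := fun i hi => hW i _ hi ht
        have h1 := hsingle (src l) (ω l) hl
        simp only [this, iff_false, ite_not, hs, ht, if_true, if_false]
        linarith
      · have : ∀ i, (src l ∈ C i ↔ tgt l ∈ C i) := fun i =>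
          ⟨fun h => (hst i l h).resolve_right ht, fun h => (hts i l h).resolve_right hs⟩
        simp [this, hs, ht]
  -- Strictness: `l₀` crosses no boundary but counts twice on the right.
  have hlt : ∑ i, (if (src l₀ ∈ C i ↔ tgt l₀ ∈ C i) then 0 else ω l₀) <
      (if src l₀ ∈ W then ω l₀ else 0) + (if tgt l₀ ∈ W then ω l₀ else 0) := by
    have h1 : ∀ i, src l₀ ∉ C i := fun i hi => hW i _ hi hs₀
    have h2 : ∀ i, tgt l₀ ∉ C i := fun i hi => hW i _ hi ht₀
    have := hω l₀
    simp only [h1, h2, hs₀, ht₀, iff_self, if_true, Finset.sum_const_zero]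
    linarith
  have hsumW : ∑ l, ((if src l ∈ W then ω l else 0) + (if tgt l ∈ W then ω l else 0)) = W.card := by
    have : ∀ l, (if src l ∈ W then ω l else 0) + (if tgt l ∈ W then ω l else 0) =
        ∑ x ∈ W, ((if src l = x then ω l else 0) + (if tgt l = x then ω l else 0)) := by
      intro l
      rw [Finset.sum_add_distrib, Finset.sum_ite_eq, Finset.sum_ite_eq]
    simp_rw [this]
    rw [Finset.sum_comm]
    simp [hdeg]
  have : (Fintype.card ι : ℚ) < W.card := by
    calc (Fintype.card ι : ℚ) = ∑ _i : ι, 1 := by simp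
      _ ≤ ∑ i, ∑ l, (if (src l ∈ C i ↔ tgt l ∈ C i) then 0 else ω l) :=
        Finset.sum_le_sum fun i _ => hcut _ (hodd i)
      _ = ∑ l, ∑ i, (if (src l ∈ C i ↔ tgt l ∈ C i) then 0 else ω l) := Finset.sum_comm
      _ < ∑ l, ((if src l ∈ W then ω l else 0) + (if tgt l ∈ W then ω l else 0)) :=
        Finset.sum_lt_sum (fun l _ => hle l) ⟨l₀, Finset.mem_univ _, hlt⟩
      _ = W.card := hsumW
  exact_mod_cast this

/-- A perfect matching, given as a fixed-point-free involution `p`, in a graph with a positive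
fractional perfect matching in which each odd cut has weight at least one. The matching may be
chosen to contain any given link. -/
theorem exists_matching_of_fractional [Fintype N] (src tgt : L → N) (ω : L → ℚ)
    (hω : ∀ l, 0 < ω l) (hne : ∀ l, src l ≠ tgt l)
    (hdeg : ∀ x, ∑ l, ((if src l = x then ω l else 0) + (if tgt l = x then ω l else 0)) = 1)
    (hcut : ∀ C : Finset N, Odd C.card →
      1 ≤ ∑ l, if (src l ∈ C ↔ tgt l ∈ C) then 0 else ω l) (l₀ : L) :
    ∃ p : N → N, (∀ x, p (p x) = x) ∧
      (∀ x, ∃ l, (src l = x ∧ tgt l = p x) ∨ (src l = p x ∧ tgt l = x)) ∧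
      p (src l₀) = tgt l₀ := by
  classical
  set u := src l₀ with hu
  set v := tgt l₀ with hv
  have huv : u ≠ v := hne l₀
  let S : Finset N := {u, v}
  let N' := {x : N // x ∉ S}
  let G : SimpleGraph N' :=
    { Adj := fun x y => ∃ l, (src l = x ∧ tgt l = y) ∨ (src l = y ∧ tgt l = x)
      symm := ⟨fun x y ⟨l, hl⟩ => ⟨l, hl.symm⟩⟩
      loopless := ⟨fun x ⟨l, hl⟩ => hne l (by rcases hl with ⟨h1, h2⟩ | ⟨h1, h2⟩ <;> rw [h1, h2])⟩ }
  -- The cut of the whole node set is empty, so that set cannot be odd.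
  have hNeven : Even (Fintype.card N) := by
    by_contra h
    have := hcut Finset.univ (by simpa using h)
    simp at this
    linarith
  have hScard : S.card = 2 := Finset.card_pair huv
  have hN'even : Even (Fintype.card N') := by
    have h1 : Fintype.card N' = Fintype.card N - S.card := by
      rw [Fintype.card_subtype_compl]; simp
    rw [Nat.even_iff] at hNeven ⊢
    omega
  have htutte : ∀ U : Set N', ¬ G.IsTutteViolator U := by
    intro U hU
    unfold SimpleGraph.IsTutteViolator at hU
    set K := ((⊤ : G.Subgraph).deleteVerts U).coe with hK
    -- Returning `u` and `v` to the barrier puts both ends of `l₀` in `W`, which makes the counting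
    -- bound strict: fewer than `|U| + 2` odd components.
    let W : Finset N := U.toFinset.image Subtype.val ∪ S
    have hWcard : W.card = U.ncard + 2 := by
      rw [Finset.card_union_of_disjoint, Finset.card_image_of_injective _ Subtype.val_injective,
        hScard, Set.ncard_eq_toFinset_card']
      rw [Finset.disjoint_left]
      intro x hx
      obtain ⟨y, -, rfl⟩ := Finset.mem_image.mp hx
      exact y.2
    let C : K.oddComponents → Finset N := fun c =>
      c.1.supp.toFinset.image fun x => (x.1 : N)
    have hinj : Function.Injective
        (fun x : ((⊤ : G.Subgraph).deleteVerts U).verts => (x.1 : N)) :=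
      Subtype.val_injective.comp Subtype.val_injective
    have hmem : ∀ c x, x ∈ C c ↔
        ∃ y : ((⊤ : G.Subgraph).deleteVerts U).verts, K.connectedComponentMk y = c.1 ∧ (y.1 : N) = x := by
      intro c x
      simp only [C, Finset.mem_image, Set.mem_toFinset, SimpleGraph.ConnectedComponent.mem_supp_iff]
    have hadj : ∀ c x z, x ∈ C c → (∃ l, (src l = x ∧ tgt l = z) ∨ (src l = z ∧ tgt l = x)) →
        z ∈ C c ∨ z ∈ W := by
      intro c x z hx hl
      by_cases hz : z ∈ W
      · exact Or.inr hz
      · left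
        simp only [W, Finset.mem_union, Finset.mem_image, Set.mem_toFinset, not_or, not_exists,
          not_and] at hz
        obtain ⟨y, hy, rfl⟩ := (hmem c x).1 hx
        have hzU : (⟨z, hz.2⟩ : N') ∉ U := fun h => hz.1 _ h rfl
        have hzv : (⟨z, hz.2⟩ : N') ∈ ((⊤ : G.Subgraph).deleteVerts U).verts := by simp [hzU]
        refine (hmem c z).2 ⟨⟨⟨z, hz.2⟩, hzv⟩, ?_, rfl⟩
        rw [← hy]
        apply SimpleGraph.ConnectedComponent.sound
        apply SimpleGraph.Adj.reachable
        have hyU : y.1 ∉ U := by simpa using y.2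
        rw [hK, SimpleGraph.Subgraph.coe_adj, SimpleGraph.Subgraph.deleteVerts_adj]
        refine ⟨by simp, hzU, by simp, hyU, ?_⟩
        obtain ⟨l, hl⟩ := hl
        exact ⟨l, hl.symm⟩
    have hlt := card_odd_sets_lt_card src tgt ω hω hdeg hcut W C
      (fun c => by
        have := c.2
        rw [Finset.card_image_of_injective _ hinj]
        rw [Set.mem_ofPred_eq, Set.ncard_eq_toFinset_card'] at this
        exact this)
      (fun c x hx hxW => by
        obtain ⟨y, hy, rfl⟩ := (hmem c x).1 hx
        have hyU : y.1 ∉ U := by simpa using y.2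
        rcases Finset.mem_union.mp hxW with h | h
        · obtain ⟨z, hz, hzy⟩ := Finset.mem_image.mp h
          rw [Subtype.val_injective hzy] at hz
          exact hyU (by simpa using hz)
        · exact y.1.2 h)
      (fun c d x hc hd => by
        obtain ⟨y, hy, hyx⟩ := (hmem c x).1 hc
        obtain ⟨z, hz, hzx⟩ := (hmem d x).1 hd
        have : y = z := hinj (hyx.trans hzx.symm)
        exact Subtype.ext (by rw [← hy, ← hz, this]))
      (fun c l h => hadj c _ _ h ⟨l, Or.inl ⟨rfl, rfl⟩⟩)
      (fun c l h => hadj c _ _ h ⟨l, Or.inr ⟨rfl, rfl⟩⟩)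
      l₀ (Finset.mem_union_right _ (by simp [S, hu])) (Finset.mem_union_right _ (by simp [S, hv]))
    rw [hWcard] at hlt
    have hcount : K.oddComponents.ncard = Fintype.card K.oddComponents := by
      rw [Set.ncard_eq_toFinset_card', Set.toFinset_card]
    have hpar := K.odd_ncard_oddComponents
    have hverts : Nat.card ((⊤ : G.Subgraph).deleteVerts U).verts + U.ncard = Fintype.card N' := by
      have : ((⊤ : G.Subgraph).deleteVerts U).verts = Uᶜ := by
        ext; simp
      rw [this, Nat.card_coe_set_eq, add_comm, Set.ncard_add_ncard_compl, Nat.card_eq_fintype_card]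
    rw [← hverts] at hN'even
    rw [← hcount] at hlt
    -- The only violation left is an excess of one, but the number of odd components has the parity
    -- of `|U|`.
    have h1 : K.oddComponents.ncard = U.ncard + 1 := by omega
    rw [h1] at hpar
    rw [Nat.odd_iff, Nat.odd_iff] at hpar
    rw [Nat.even_iff] at hN'even
    omega
  obtain ⟨M, hM⟩ := SimpleGraph.tutte.mpr htutte
  rw [SimpleGraph.Subgraph.isPerfectMatching_iff] at hM
  choose q hq hq' using hM
  have hqq : ∀ x, q (q x) = x := fun x => (hq' (q x) x (hq x).symm).symm
  refine ⟨fun x => if hx : x ∈ S then (if x = u then v else u) else q ⟨x, hx⟩, ?_, ?_, ?_⟩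
  · intro x
    by_cases hx : x ∈ S
    · have hx' : x = u ∨ x = v := by simpa [S] using hx
      rcases hx' with rfl | rfl
      · simp [S, huv.symm]
      · simp [S, huv.symm]
    · simp only [hx, dif_neg, not_false_eq_true, (q ⟨x, hx⟩).2, Subtype.coe_eta, hqq]
  · intro x
    by_cases hx : x ∈ S
    · have hx' : x = u ∨ x = v := by simpa [S] using hx
      refine ⟨l₀, ?_⟩
      rcases hx' with rfl | rfl
      · simp [S, ← hu, ← hv]
      · simp [S, ← hu, ← hv, huv.symm]
    · simp only [hx, dif_neg, not_false_eq_true]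
      exact M.adj_sub (hq ⟨x, hx⟩)
  · simp [S]

end FractionalMatching

namespace SignedGraph

/-! ### The gadget graph and its fractional perfect matching -/

section Gadget

/-- The nodes of the gadget graph: `n v` core nodes at each vertex `v`, one node for each half-edge
and one further node for each positive edge. -/
abbrev GadgetNode {V E : Type*} (G : SignedGraph V E) (n : V → ℕ) : Type _ :=
  (Σ v, Fin (n v)) ⊕ (E × Bool) ⊕ {e // G.sign e = 1}

/-- The links of the gadget graph: those between a half-edge and the core nodes at its end, and one
for each half-edge in the interior of its edge. -/
abbrev GadgetLink {V E : Type*} (G : SignedGraph V E) (n : V → ℕ) : Type _ :=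
  (Σ h : E × Bool, Fin (n (G.endOf h))) ⊕ (E × Bool)

/-- The first end of a link, which is a half-edge. -/
def gadgetSrc {V E : Type*} (G : SignedGraph V E) (n : V → ℕ) :
    G.GadgetLink n → G.GadgetNode n
  | .inl l => .inr (.inl l.1)
  | .inr h => .inr (.inl h)

/-- The second end of a link. -/
def gadgetTgt {V E : Type*} (G : SignedGraph V E) (n : V → ℕ) :
    G.GadgetLink n → G.GadgetNode n
  | .inl l => .inl ⟨G.endOf l.1, l.2⟩
  | .inr h => if hs : G.sign h.1 = 1 then .inr (.inr ⟨h.1, hs⟩) else .inr (.inl (h.1, !h.2))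

/-- The weight of a link. -/
def gadgetWeight {V E : Type*} (G : SignedGraph V E) (n : V → ℕ) (b : E × Bool → ℕ) :
    G.GadgetLink n → ℚ
  | .inl l => b l.1 / (3 * n (G.endOf l.1))
  | .inr h => if G.sign h.1 = 1 then 1 - b h / 3 else (1 - b h / 3) / 2

/-- Half-edge weights in `{1, 2}` that add up to `3` on positive edges, agree on negative edges, and
add up to `3 * n v` at each vertex `v`. -/
structure IsBalanced {V E : Type*} [Fintype E] [DecidableEq V] (G : SignedGraph V E) (n : V → ℕ)
    (b : E × Bool → ℕ) : Prop where
  one_or_two : ∀ h, b h = 1 ∨ b h = 2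
  add_of_pos : ∀ e, G.sign e = 1 → b (e, false) + b (e, true) = 3
  eq_of_neg : ∀ e, G.sign e ≠ 1 → b (e, false) = b (e, true)
  sum_eq : ∀ v, ∑ h, (if G.endOf h = v then b h else 0) = 3 * n v

variable {V E : Type*} [Fintype E] [DecidableEq V] {G : SignedGraph V E} {n : V → ℕ}
  {b : E × Bool → ℕ}

theorem IsBalanced.core_pos (hb : G.IsBalanced n b) (h : E × Bool) : 0 < n (G.endOf h) := by
  have h1 := hb.sum_eq (G.endOf h)
  have h2 : (if G.endOf h = G.endOf h then b h else 0) ≤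
      ∑ h', (if G.endOf h' = G.endOf h then b h' else 0) :=
    Finset.single_le_sum (f := fun h' => if G.endOf h' = G.endOf h then b h' else 0)
      (fun _ _ => Nat.zero_le _) (Finset.mem_univ h)
  rw [if_pos rfl] at h2
  have := hb.one_or_two h
  omega

theorem IsBalanced.weight_pos (hb : G.IsBalanced n b) (l : G.GadgetLink n) :
    0 < G.gadgetWeight n b l := by
  rcases l with ⟨h, i⟩ | h
  · have := hb.core_pos h
    have h2 : 0 < b h := by have := hb.one_or_two h; omega
    simp only [gadgetWeight]
    positivity
  · simp only [gadgetWeight]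
    rcases hb.one_or_two h with h1 | h1 <;> rw [h1] <;> split_ifs <;> norm_num

theorem gadgetSrc_ne_gadgetTgt {V E : Type*} {G : SignedGraph V E} {n : V → ℕ}
    (l : G.GadgetLink n) : G.gadgetSrc n l ≠ G.gadgetTgt n l := by
  rcases l with ⟨h, i⟩ | ⟨e, c⟩
  · simp [gadgetSrc, gadgetTgt]
  · simp only [gadgetSrc, gadgetTgt]
    split_ifs
    · simp
    · cases c <;> simp

theorem IsBalanced.sum_div_eq_one (hb : G.IsBalanced n b) {v : V} (hv : 0 < n v) :
    ∑ h, (if G.endOf h = v then (b h : ℚ) / (3 * n v) else 0) = 1 := by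
  have h1 : ∀ h, (if G.endOf h = v then (b h : ℚ) / (3 * n v) else 0) =
      ((if G.endOf h = v then b h else 0 : ℕ) : ℚ) / (3 * n v) := by
    intro h; split_ifs <;> simp
  simp_rw [h1]
  rw [← Finset.sum_div, ← Nat.cast_sum, hb.sum_eq]
  have : (n v : ℚ) ≠ 0 := by positivity
  push_cast
  field_simp

/-- A half-edge node gets `b / 3` from its cores and `1 - b / 3` from inside the edge; a negative
edge carries two parallel inner links, hence their halved weights. The middle node of a positive
edge gets `2 - 3 / 3`. -/
theorem IsBalanced.degree_eq_one [DecidableEq E] (hb : G.IsBalanced n b) (x : G.GadgetNode n) :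
    ∑ l, ((if G.gadgetSrc n l = x then G.gadgetWeight n b l else 0) +
      (if G.gadgetTgt n l = x then G.gadgetWeight n b l else 0)) = 1 := by
  rw [Fintype.sum_sum_type, Fintype.sum_sigma]
  rcases x with ⟨v, i⟩ | ⟨e, c⟩ | ⟨e, he⟩
  · have h1 : ∀ h, (∑ j : Fin (n (G.endOf h)),
        if (⟨G.endOf h, j⟩ : Σ v, Fin (n v)) = ⟨v, i⟩ then
          (b h : ℚ) / (3 * n (G.endOf h)) else 0) =
        if G.endOf h = v then (b h : ℚ) / (3 * n v) else 0 := by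
      intro h
      by_cases hv : G.endOf h = v
      · subst hv
        simp
      · have : ∀ j, (⟨G.endOf h, j⟩ : Σ v, Fin (n v)) ≠ ⟨v, i⟩ := fun j hj =>
          hv (congrArg Sigma.fst hj)
        simp [this, hv]
    have h2 : ∀ h, G.gadgetTgt n (.inr h) ≠ .inl ⟨v, i⟩ := by
      intro h
      simp only [gadgetTgt]
      split_ifs <;> simp
    simp only [h2, if_false]
    simp only [gadgetSrc, gadgetTgt, gadgetWeight, reduceCtorEq, if_false, zero_add, Sum.inl.injEq,
      h1, Finset.sum_const_zero, add_zero]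
    exact hb.sum_div_eq_one i.pos
  · have hn : (n (G.endOf (e, c)) : ℚ) ≠ 0 := by
      have := hb.core_pos (e, c)
      positivity
    have h1 : ∀ h, (∑ _j : Fin (n (G.endOf h)),
        if h = (e, c) then (b h : ℚ) / (3 * n (G.endOf h)) else 0) =
        if h = (e, c) then (b h : ℚ) / 3 else 0 := by
      intro h
      by_cases hh : h = (e, c)
      · subst hh
        simp
        field_simp
      · simp [hh]
    simp only [gadgetSrc, gadgetTgt, gadgetWeight, reduceCtorEq, if_false, add_zero,
      Sum.inr.injEq, Sum.inl.injEq, h1, Finset.sum_ite_eq', Finset.mem_univ, if_true,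
      Finset.sum_add_distrib]
    by_cases hs : G.sign e = 1
    · have h2 : ∀ h : E × Bool, ((if hs : G.sign h.1 = 1 then .inr (.inr ⟨h.1, hs⟩) else
          .inr (.inl (h.1, !h.2)) : G.GadgetNode n) = .inr (.inl (e, c))) ↔ False := by
        rintro ⟨e', c'⟩
        split_ifs with hs'
        · simp
        · simp only [Sum.inr.injEq, Sum.inl.injEq, Prod.mk.injEq, iff_false, not_and]
          rintro rfl
          exact absurd hs hs'
      simp [h2, hs]
    · have h2 : ∀ h : E × Bool, ((if hs : G.sign h.1 = 1 then .inr (.inr ⟨h.1, hs⟩) else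
          .inr (.inl (h.1, !h.2)) : G.GadgetNode n) = .inr (.inl (e, c))) ↔ h = (e, !c) := by
        rintro ⟨e', c'⟩
        split_ifs with hs'
        · simp only [Sum.inr.injEq, reduceCtorEq, Prod.mk.injEq, false_iff, not_and]
          rintro rfl
          exact absurd hs' hs
        · simp only [Sum.inr.injEq, Sum.inl.injEq, Prod.mk.injEq]
          cases c <;> cases c' <;> simp
      have h3 : b (e, !c) = b (e, c) := by
        have := hb.eq_of_neg e hs
        cases c <;> simp [this]
      simp [h2, hs, h3]
  · have h2 : ∀ h : E × Bool, ((if hs : G.sign h.1 = 1 then .inr (.inr ⟨h.1, hs⟩) else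
          .inr (.inl (h.1, !h.2)) : G.GadgetNode n) = .inr (.inr ⟨e, he⟩)) ↔ h.1 = e := by
      rintro ⟨e', c'⟩
      split_ifs with hs'
      · simp
      · simp only [Sum.inr.injEq, reduceCtorEq, false_iff]
        rintro rfl
        exact absurd he hs'
    simp only [gadgetSrc, gadgetTgt, gadgetWeight, reduceCtorEq, if_false, add_zero,
      Sum.inr.injEq, h2, Finset.sum_const_zero, zero_add, Fintype.sum_prod_type, Fintype.sum_bool,
      Finset.sum_add_distrib, Finset.sum_ite_eq', Finset.mem_univ, if_true, he]
    have : (b (e, false) : ℚ) + b (e, true) = 3 := by exact_mod_cast hb.add_of_pos e he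
    linarith

/-- A bridgeless graph has no edge cut consisting of a single edge. -/
theorem Bridgeless.mem_iff_mem {V E : Type*} {G : SignedGraph V E} (hG : G.Bridgeless) (X : Set V)
    (e : E) (h : ∀ e', e' ≠ e → (G.endOf (e', false) ∈ X ↔ G.endOf (e', true) ∈ X)) :
    G.endOf (e, false) ∈ X ↔ G.endOf (e, true) ∈ X := by
  have he := hG e
  rw [IsCutEdge, not_not] at he
  generalize G.endOf (e, true) = y at he ⊢
  induction he with
  | refl => rfl
  | tail _ hadj ih =>
    refine ih.trans ?_
    obtain ⟨e', ⟨c, rfl, rfl⟩, he'⟩ := hadj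
    have := h e' he'
    cases c
    · exact this
    · exact this.symm

end Gadget

/-! ### Odd cuts of the gadget graph -/

section Cut

variable {V E : Type*} [Fintype E] [DecidableEq V] {G : SignedGraph V E} {n : V → ℕ}
  {b : E × Bool → ℕ}

/-- Each half-edge at `v` is linked to a core inside `C` and to one outside, so one of its core
links crosses; these links alone contribute `∑ b / (3 * n v) = 1`. -/
theorem IsBalanced.one_le_cut_of_partial [DecidableEq E] (hb : G.IsBalanced n b)
    (C : Finset (G.GadgetNode n))
    {v : V} {i j : Fin (n v)} (hi : .inl ⟨v, i⟩ ∈ C) (hj : .inl ⟨v, j⟩ ∉ C) :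
    1 ≤ ∑ l, if (G.gadgetSrc n l ∈ C ↔ G.gadgetTgt n l ∈ C) then 0 else G.gadgetWeight n b l := by
  rw [Fintype.sum_sum_type, Fintype.sum_sigma, ← hb.sum_div_eq_one i.pos]
  have h0 : ∀ l, 0 ≤ if (G.gadgetSrc n l ∈ C ↔ G.gadgetTgt n l ∈ C) then 0
      else G.gadgetWeight n b l := by
    intro l
    have := (hb.weight_pos l).le
    split_ifs <;> simp [this]
  refine le_add_of_le_of_nonneg (Finset.sum_le_sum fun h _ => ?_)
    (Finset.sum_nonneg fun _ _ => h0 _)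
  by_cases hv : G.endOf h = v
  · subst hv
    rw [if_pos rfl]
    have key : ∀ k : Fin (n (G.endOf h)),
        ¬ (G.gadgetSrc n (.inl ⟨h, k⟩) ∈ C ↔ G.gadgetTgt n (.inl ⟨h, k⟩) ∈ C) →
        (b h : ℚ) / (3 * n (G.endOf h)) ≤ ∑ k : Fin (n (G.endOf h)),
          if (G.gadgetSrc n (.inl ⟨h, k⟩) ∈ C ↔ G.gadgetTgt n (.inl ⟨h, k⟩) ∈ C) then 0
          else G.gadgetWeight n b (.inl ⟨h, k⟩) := by
      intro k hk
      refine le_trans ?_ (Finset.single_le_sum (fun _ _ => h0 _) (Finset.mem_univ k))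
      rw [if_neg hk]
      exact le_rfl
    by_cases hC : G.gadgetSrc n (.inl ⟨h, i⟩) ∈ C
    · exact key j fun hk => hj (hk.1 hC)
    · exact key i fun hk => hC (hk.2 hi)
  · rw [if_neg hv]
    exact Finset.sum_nonneg fun _ _ => h0 _

/-- Three times the weight of the links of the edge `e` in the cut of `C`, where all or none of the
cores at a vertex are in `C`, depending on whether the vertex is in `X`. -/
def edgeCut (G : SignedGraph V E) (n : V → ℕ) (b : E × Bool → ℕ) [DecidableEq E]
    (C : Finset (G.GadgetNode n)) (X : Finset V) (e : E) : ℕ :=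
  (∑ c, if (.inr (.inl (e, c)) ∈ C ↔ G.endOf (e, c) ∈ X) then 0 else b (e, c)) +
  if hs : G.sign e = 1 then
    ∑ c, if (.inr (.inl (e, c)) ∈ C ↔ .inr (.inr ⟨e, hs⟩) ∈ C) then 0 else 3 - b (e, c)
  else if (.inr (.inl (e, false)) ∈ C ↔ .inr (.inl (e, true)) ∈ C) then 0 else 3 - b (e, false)

/-- The number of nodes on the edge `e` that lie in `C`. -/
def edgeNodes (G : SignedGraph V E) (n : V → ℕ) [DecidableEq E]
    (C : Finset (G.GadgetNode n)) (e : E) : ℕ :=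
  (∑ c, if .inr (.inl (e, c)) ∈ C then 1 else 0) +
  if hs : G.sign e = 1 then (if .inr (.inr ⟨e, hs⟩) ∈ C then 1 else 0) else 0

variable [DecidableEq E] (C : Finset (G.GadgetNode n)) (X : Finset V)

/-- Each node on the edge has tripled degree 3, and a link with both ends in `C` is counted twice;
so modulo 2 the cut is the number of these nodes in `C` plus `b` at the ends in `X`. -/
theorem IsBalanced.even_edgeCut_add (hb : G.IsBalanced n b) (e : E) :
    Even (G.edgeCut n b C X e + G.edgeNodes n C e +
      ∑ c, if G.endOf (e, c) ∈ X then b (e, c) else 0) := by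
  have h1 := hb.one_or_two (e, false)
  have h2 := hb.one_or_two (e, true)
  simp only [edgeCut, edgeNodes, Fintype.sum_bool]
  rw [Nat.even_iff]
  by_cases hs : G.sign e = 1
  · have h3 := hb.add_of_pos e hs
    simp only [hs, dif_pos]
    by_cases p1 : (.inr (.inl (e, false)) : G.GadgetNode n) ∈ C <;>
    by_cases p2 : (.inr (.inl (e, true)) : G.GadgetNode n) ∈ C <;>
    by_cases p3 : (.inr (.inr ⟨e, hs⟩) : G.GadgetNode n) ∈ C <;>
    by_cases p4 : G.endOf (e, false) ∈ X <;>
    by_cases p5 : G.endOf (e, true) ∈ X <;>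
    simp only [p1, p2, p3, p4, p5, if_true, if_false, iff_true, iff_false,
      not_true] <;> omega
  · have h3 := hb.eq_of_neg e hs
    simp only [hs, dif_neg, not_false_iff]
    by_cases p1 : (.inr (.inl (e, false)) : G.GadgetNode n) ∈ C <;>
    by_cases p2 : (.inr (.inl (e, true)) : G.GadgetNode n) ∈ C <;>
    by_cases p4 : G.endOf (e, false) ∈ X <;>
    by_cases p5 : G.endOf (e, true) ∈ X <;>
    simp only [p1, p2, p4, p5, if_true, if_false, iff_true, iff_false,
      not_true] <;> omega

/-- The edge acts as a path between its ends whose steps have tripled weight 1 or 2, so the values 0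
and 1 mean that no step, or exactly one, crosses the cut. -/
theorem IsBalanced.mem_iff_mem_of_edgeCut (hb : G.IsBalanced n b) (e : E) :
    (G.edgeCut n b C X e = 0 → (G.endOf (e, false) ∈ X ↔ G.endOf (e, true) ∈ X)) ∧
    (G.edgeCut n b C X e = 1 → ¬ (G.endOf (e, false) ∈ X ↔ G.endOf (e, true) ∈ X)) := by
  have h1 := hb.one_or_two (e, false)
  have h2 := hb.one_or_two (e, true)
  simp only [edgeCut, Fintype.sum_bool]
  by_cases hs : G.sign e = 1
  · have h3 := hb.add_of_pos e hs
    simp only [hs, dif_pos]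
    by_cases p1 : (.inr (.inl (e, false)) : G.GadgetNode n) ∈ C <;>
    by_cases p2 : (.inr (.inl (e, true)) : G.GadgetNode n) ∈ C <;>
    by_cases p3 : (.inr (.inr ⟨e, hs⟩) : G.GadgetNode n) ∈ C <;>
    by_cases p4 : G.endOf (e, false) ∈ X <;>
    by_cases p5 : G.endOf (e, true) ∈ X <;>
    simp only [p1, p2, p3, p4, p5, if_true, if_false, iff_true, iff_false, not_true,
      not_false_iff, imp_false, imp_true_iff, and_true, true_and] <;> omega
  · have h3 := hb.eq_of_neg e hs
    simp only [hs, dif_neg, not_false_iff]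
    by_cases p1 : (.inr (.inl (e, false)) : G.GadgetNode n) ∈ C <;>
    by_cases p2 : (.inr (.inl (e, true)) : G.GadgetNode n) ∈ C <;>
    by_cases p4 : G.endOf (e, false) ∈ X <;>
    by_cases p5 : G.endOf (e, true) ∈ X <;>
    simp only [p1, p2, p4, p5, if_true, if_false, iff_true, iff_false, not_true,
      not_false_iff, imp_false, imp_true_iff, and_true, true_and] <;> omega

variable {C X}

/-- All core links of a half-edge cross together, so the denominator `n v` cancels and the tripled
weight is an integer, open to parity arguments. -/
theorem IsBalanced.three_mul_cut (hb : G.IsBalanced n b)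
    (hX : ∀ v i, .inl ⟨v, i⟩ ∈ C ↔ v ∈ X) :
    3 * (∑ l, if (G.gadgetSrc n l ∈ C ↔ G.gadgetTgt n l ∈ C) then 0 else G.gadgetWeight n b l) =
      ((∑ e, G.edgeCut n b C X e : ℕ) : ℚ) := by
  rw [Fintype.sum_sum_type, Fintype.sum_sigma, ← Finset.sum_add_distrib, Fintype.sum_prod_type,
    Finset.mul_sum, Nat.cast_sum]
  refine Finset.sum_congr rfl fun e _ => ?_
  have hcore : ∀ c, (∑ i, if (G.gadgetSrc n (.inl ⟨(e, c), i⟩) ∈ C ↔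
      G.gadgetTgt n (.inl ⟨(e, c), i⟩) ∈ C) then 0 else G.gadgetWeight n b (.inl ⟨(e, c), i⟩)) =
      if (.inr (.inl (e, c)) ∈ C ↔ G.endOf (e, c) ∈ X) then 0 else (b (e, c) : ℚ) / 3 := by
    intro c
    have hn : (n (G.endOf (e, c)) : ℚ) ≠ 0 := by
      have := hb.core_pos (e, c)
      positivity
    simp only [gadgetSrc, gadgetTgt, gadgetWeight, hX, Finset.sum_const, Finset.card_univ,
      Fintype.card_fin, nsmul_eq_mul]
    split_ifs
    · simp
    · field_simp
  simp only [hcore]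
  have hsub : ∀ c, ((3 - b (e, c) : ℕ) : ℚ) = 3 - b (e, c) := by
    intro c
    have := hb.one_or_two (e, c)
    rw [Nat.cast_sub (by omega)]
    simp
  simp only [edgeCut, Fintype.sum_bool]
  by_cases hs : G.sign e = 1
  · simp only [gadgetSrc, gadgetTgt, gadgetWeight, hs, dif_pos, if_true]
    push_cast [hsub]
    simp only [mul_add, mul_ite, mul_zero]
    ring_nf
  · simp only [gadgetSrc, gadgetTgt, gadgetWeight, hs, dif_neg, not_false_iff, if_false,
      Bool.not_true, Bool.not_false, ← hb.eq_of_neg e hs,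
      iff_comm (a := (.inr (.inl (e, true)) : G.GadgetNode n) ∈ C)
        (b := (.inr (.inl (e, false)) : G.GadgetNode n) ∈ C)]
    push_cast [hsub]
    split_ifs <;> ring

theorem card_eq_sum_edgeNodes [Fintype V] (hX : ∀ v i, .inl ⟨v, i⟩ ∈ C ↔ v ∈ X) :
    C.card = ∑ v ∈ X, n v + ∑ e, G.edgeNodes n C e := by
  have h1 : C.card = ∑ x, if x ∈ C then 1 else 0 := by simp
  rw [h1, Fintype.sum_sum_type, Fintype.sum_sum_type, Fintype.sum_sigma, Fintype.sum_prod_type]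
  simp only [hX, edgeNodes, Finset.sum_add_distrib]
  congr 1
  · simp
  · congr 1
    let F : E → ℕ := fun e => if hs : G.sign e = 1 then
      (if (.inr (.inr ⟨e, hs⟩) : G.GadgetNode n) ∈ C then 1 else 0) else 0
    have h2 := Finset.sum_subtype (F := inferInstance) (Finset.univ.filter fun e => G.sign e = 1)
      (p := fun e => G.sign e = 1) (by simp) F
    have h3 : ∀ x : {e // G.sign e = 1}, (if (.inr (.inr x) : G.GadgetNode n) ∈ C then 1 else 0) =
        F x := fun x => by simp [F, x.2]
    simp_rw [h3]
    rw [← h2, Finset.sum_filter]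
    refine Finset.sum_congr rfl fun e _ => ?_
    simp only [F]
    split_ifs <;> rfl

/-- In a bridgeless graph the odd cuts of the gadget graph have weight at least one. -/
theorem IsBalanced.one_le_cut [Fintype V] (hG : G.Bridgeless) (hb : G.IsBalanced n b)
    (C : Finset (G.GadgetNode n)) (hC : Odd C.card) :
    1 ≤ ∑ l, if (G.gadgetSrc n l ∈ C ↔ G.gadgetTgt n l ∈ C) then 0 else G.gadgetWeight n b l := by
  classical
  by_cases hpart : ∃ v, ∃ i j : Fin (n v), .inl ⟨v, i⟩ ∈ C ∧ .inl ⟨v, j⟩ ∉ C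
  · obtain ⟨v, i, j, hi, hj⟩ := hpart
    exact hb.one_le_cut_of_partial C hi hj
  push Not at hpart
  let X : Finset V := Finset.univ.filter fun v => ∃ i : Fin (n v), .inl ⟨v, i⟩ ∈ C
  have hX : ∀ v i, .inl ⟨v, i⟩ ∈ C ↔ v ∈ X := by
    intro v i
    simp only [X, Finset.mem_filter, Finset.mem_univ, true_and]
    exact ⟨fun h => ⟨i, h⟩, fun ⟨j, hj⟩ => hpart v j i hj⟩
  have hcut := hb.three_mul_cut hX
  have hcard := card_eq_sum_edgeNodes hX
  have heven : Even (∑ e, (G.edgeCut n b C X e + G.edgeNodes n C e +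
      ∑ c, if G.endOf (e, c) ∈ X then b (e, c) else 0)) :=
    Finset.even_sum _ fun e _ => hb.even_edgeCut_add C X e
  have hbX : ∑ e, ∑ c, (if G.endOf (e, c) ∈ X then b (e, c) else 0) = 3 * ∑ v ∈ X, n v := by
    rw [← Fintype.sum_prod_type', Finset.mul_sum]
    simp_rw [← hb.sum_eq]
    rw [Finset.sum_comm]
    refine Finset.sum_congr rfl fun h _ => ?_
    rw [Finset.sum_ite_eq]
  rw [Finset.sum_add_distrib, Finset.sum_add_distrib, hbX] at heven
  have hodd : (∑ e, G.edgeCut n b C X e) % 2 = 1 := by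
    rw [Nat.even_iff] at heven
    rw [Nat.odd_iff] at hC
    omega
  -- A total of 1 would come from a single edge, the only one between `X` and its complement: a
  -- bridge.
  have hne : ∑ e, G.edgeCut n b C X e ≠ 1 := by
    intro h1
    obtain ⟨e, -, he⟩ := Finset.exists_ne_zero_of_sum_ne_zero (h1.symm ▸ one_ne_zero)
    have hsplit := Finset.add_sum_erase Finset.univ (G.edgeCut n b C X) (Finset.mem_univ e)
    have he1 : G.edgeCut n b C X e = 1 := by omega
    have hrest : ∑ e' ∈ Finset.univ.erase e, G.edgeCut n b C X e' = 0 := by omega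
    rw [Finset.sum_eq_zero_iff] at hrest
    refine (hb.mem_iff_mem_of_edgeCut C X e).2 he1 ?_
    exact hG.mem_iff_mem (X : Set V) e fun e' he' =>
      (hb.mem_iff_mem_of_edgeCut C X e').1 (hrest e' (by simp [he']))
  have h3 : 3 ≤ ∑ e, G.edgeCut n b C X e := by omega
  have h4 : (3 : ℚ) ≤ ((∑ e, G.edgeCut n b C X e : ℕ) : ℚ) := by exact_mod_cast h3
  rw [← hcut] at h4
  linarith

end Cut

/-! ### Rounding by a perfect matching -/

/-- A bridgeless balanced weighting can be rounded to a `0`-`1`-weighting, with a prescribed value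
at one half-edge. -/
theorem IsBalanced.exists_rounding {V E : Type*} [Fintype V] [Fintype E] [DecidableEq V]
    {G : SignedGraph V E} {n : V → ℕ} {b : E × Bool → ℕ} (hG : G.Bridgeless)
    (hb : G.IsBalanced n b) (e₀ : E) (k : ℕ) (hk : k = 0 ∨ k = 1) :
    ∃ c : E × Bool → ℕ, (∀ h, c h = 0 ∨ c h = 1) ∧
      (∀ e, G.sign e = 1 → c (e, false) + c (e, true) = 1) ∧
      (∀ e, G.sign e ≠ 1 → c (e, false) = c (e, true)) ∧
      (∀ v, ∑ h, (if G.endOf h = v then c h else 0) = n v) ∧ c (e₀, false) = k := by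
  classical
  let half : E × Bool → G.GadgetNode n := fun h => .inr (.inl h)
  obtain ⟨l₀, hs₀, hl₀⟩ : ∃ l : G.GadgetLink n, G.gadgetSrc n l = half (e₀, false) ∧
      (if (G.gadgetTgt n l).isLeft then 1 else 0) = k := by
    -- The value 0 is forced by an inner link at `(e₀, false)`, the value 1 by a core link.
    rcases hk with rfl | rfl
    · refine ⟨.inr (e₀, false), rfl, ?_⟩
      simp only [gadgetTgt]
      split_ifs <;> simp_all
    · exact ⟨.inl ⟨(e₀, false), ⟨0, hb.core_pos _⟩⟩, rfl, rfl⟩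
  obtain ⟨p, hpp, hlink, hp₀⟩ := exists_matching_of_fractional (G.gadgetSrc n) (G.gadgetTgt n)
    (G.gadgetWeight n b) hb.weight_pos gadgetSrc_ne_gadgetTgt hb.degree_eq_one
    (hb.one_le_cut hG) l₀
  have hpinj : Function.Injective p := Function.Involutive.injective hpp
  have hhalf : ∀ h, (∃ i, p (half h) = .inl ⟨G.endOf h, i⟩) ∨
      p (half h) = G.gadgetTgt n (.inr h) := by
    intro h
    obtain ⟨l, ⟨hs, ht⟩ | ⟨hs, ht⟩⟩ := hlink (half h)
    · rcases l with ⟨h', i⟩ | h'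
      · obtain rfl : h' = h := by simpa [gadgetSrc, half] using hs
        exact Or.inl ⟨i, ht.symm⟩
      · obtain rfl : h' = h := by simpa [gadgetSrc, half] using hs
        exact Or.inr ht.symm
    · right
      rcases l with ⟨h', i⟩ | ⟨e, d⟩
      · simp [gadgetTgt, half] at ht
      · by_cases he : G.sign e = 1
        · simp [gadgetTgt, half, he] at ht
        · obtain rfl : (e, !d) = h := by simpa [gadgetTgt, half, he] using ht
          rw [← hs]
          simp [gadgetTgt, gadgetSrc, he]
  have hcore : ∀ v i, ∃ h, p (.inl ⟨v, i⟩) = half h ∧ G.endOf h = v := by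
    intro v i
    obtain ⟨l, ⟨hs, ht⟩ | ⟨hs, ht⟩⟩ := hlink (.inl ⟨v, i⟩)
    · rcases l with l | l <;> simp [gadgetSrc] at hs
    · rcases l with ⟨h, j⟩ | h
      · refine ⟨h, hs.symm, ?_⟩
        simp only [gadgetTgt, Sum.inl.injEq, Sigma.mk.injEq] at ht
        exact ht.1
      · simp only [gadgetTgt] at ht
        split_ifs at ht
  have hmid : ∀ e (he : G.sign e = 1), ∃ d, p (half (e, d)) = .inr (.inr ⟨e, he⟩) := by
    intro e he
    obtain ⟨l, ⟨hs, ht⟩ | ⟨hs, ht⟩⟩ := hlink (.inr (.inr ⟨e, he⟩))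
    · rcases l with l | l <;> simp [gadgetSrc] at hs
    · rcases l with ⟨h, j⟩ | ⟨e', d⟩
      · simp [gadgetTgt] at ht
      · simp only [gadgetTgt] at ht
        split_ifs at ht with he'
        · obtain rfl : e' = e := by simpa using ht
          refine ⟨d, ?_⟩
          have : p (.inr (.inr ⟨e', he⟩)) = half (e', d) := hs.symm
          rw [← this, hpp]
        · simp at ht
  have htgt : ∀ h, (G.gadgetTgt n (.inr h)).isLeft = false := by
    intro h
    simp only [gadgetTgt]
    split_ifs <;> rfl
  let c : E × Bool → ℕ := fun h => if (p (half h)).isLeft then 1 else 0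
  have hc1 : ∀ h, c h = 1 ↔ ∃ i, p (half h) = .inl ⟨G.endOf h, i⟩ := by
    intro h
    rcases hhalf h with ⟨i, hi⟩ | hi
    · simp [c, hi]
    · simp only [c, hi, htgt]
      simp only [Bool.false_eq_true, if_false, zero_ne_one, false_iff, not_exists]
      intro i hi'
      have := htgt h
      rw [hi'] at this
      simp at this
  have hc01 : ∀ h, c h = 0 ∨ c h = 1 := by
    intro h
    simp only [c]
    split_ifs <;> simp
  have hc0 : ∀ h, c h = 0 → p (half h) = G.gadgetTgt n (.inr h) := by
    intro h h0
    refine (hhalf h).resolve_left fun hi => ?_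
    rw [← hc1] at hi
    omega
  have hc0' : ∀ h x, p (half h) = .inr x → c h = 0 := by
    intro h x hx
    simp [c, hx]
  refine ⟨c, hc01, ?_, ?_, ?_, ?_⟩
  · intro e he
    obtain ⟨d, hd⟩ := hmid e he
    have h0 := hc0' _ _ hd
    -- The middle node is taken by `(e, d)`, so the other half-edge must go to a core.
    have h1 : c (e, !d) = 1 := by
      refine (hc01 _).resolve_left fun h => ?_
      have h2 := hc0 _ h
      simp only [gadgetTgt, he, dif_pos] at h2
      have := hpinj (h2.trans hd.symm)
      simp [half] at this
    cases d <;> simp only [Bool.not_true, Bool.not_false] at h1 <;> omega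
  · intro e he
    -- On a negative edge, a half-edge not matched to a core is matched to its opposite.
    have key : ∀ d, c (e, d) = 0 → c (e, !d) = 0 := by
      intro d h0
      have h2 := hc0 _ h0
      simp only [gadgetTgt, he, dif_neg, not_false_iff] at h2
      have h3 : p (half (e, !d)) = half (e, d) := by
        rw [← hpp (half (e, d)), h2]
      exact hc0' _ _ h3
    have h1 := key false
    have h2 := key true
    have h3 := hc01 (e, false)
    have h4 := hc01 (e, true)
    simp only [Bool.not_true, Bool.not_false] at h1 h2
    omega
  · intro v
    have hsum : ∑ h, (if G.endOf h = v then c h else 0) =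
        (Finset.univ.filter fun h => G.endOf h = v ∧ c h = 1).card := by
      rw [Finset.card_filter]
      refine Finset.sum_congr rfl fun h _ => ?_
      rcases hc01 h with h0 | h0 <;> simp [h0]
    rw [hsum]
    choose g hg hgv using hcore v
    have : (Finset.univ : Finset (Fin (n v))).card = n v := by simp
    rw [← this]
    symm
    refine Finset.card_bij (fun i _ => g i) ?_ ?_ ?_
    · intro i _
      simp only [Finset.mem_filter, Finset.mem_univ, true_and]
      refine ⟨hgv i, ?_⟩
      have : p (half (g i)) = .inl ⟨v, i⟩ := by rw [← hg, hpp]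
      simp [c, this]
    · intro i _ j _ hij
      have := hpinj ((hg i).trans ((congrArg half hij).trans (hg j).symm))
      simpa using this
    · intro h hh
      simp only [Finset.mem_filter, Finset.mem_univ, true_and] at hh
      obtain ⟨rfl, hh⟩ := hh
      obtain ⟨i, hi⟩ := (hc1 h).1 hh
      refine ⟨i, Finset.mem_univ _, ?_⟩
      have := (hg i).symm.trans (congrArg p hi.symm)
      rw [hpp] at this
      simpa [half] using this
  · simp only [c]
    rw [← hs₀, hp₀, hl₀]

/-! ### From flows to balanced weights and back -/

/-- In a signed graph the directions of the two half-edges of an edge determine one another. -/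
theorem Orientation.dir_true {V E : Type*} {G : SignedGraph V E} (τ : G.Orientation) (e : E) :
    τ.dir (e, true) = - G.sign e * τ.dir (e, false) := by
  rw [← τ.dir_mul_dir e, mul_comm (τ.dir (e, false)), mul_assoc, Int.units_mul_self, mul_one]

/-- Any two orientations agree up to reversing edges, and a flow under one of them yields a flow
under the other. -/
theorem boundary_reorient {V E A : Type*} [Fintype E] [AddCommGroup A] {G : SignedGraph V E}
    (τ τ' : G.Orientation) (f : E → A) (v : V) :
    G.boundary τ' (fun e => ((τ.dir (e, false) * τ'.dir (e, false) : ℤˣ) : ℤ) • f e) v =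
      G.boundary τ f v := by
  unfold boundary
  refine Finset.sum_congr rfl ?_
  rintro ⟨e, c⟩ -
  rw [smul_smul, ← Units.val_mul]
  congr 2
  cases c
  · rw [mul_left_comm, Int.units_mul_self, mul_one]
  · rw [τ.dir_true, τ'.dir_true, mul_assoc, mul_left_comm (τ'.dir (e, false)), Int.units_mul_self,
      mul_one]

/-- A nowhere-zero `ℤ₃`-flow becomes the constant flow `1` under a suitable orientation. -/
theorem AdmitsNZF.exists_isFlow_one {V E : Type*} [Fintype E] {G : SignedGraph V E}
    (h : G.AdmitsNZF (ZMod 3)) : ∃ τ : G.Orientation, G.IsFlow τ (fun _ => (1 : ZMod 3)) := by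
  obtain ⟨τ, f, hf, hf0⟩ := h
  let s : E → ℤˣ := fun e => if f e = 1 then 1 else -1
  let τ' : G.Orientation :=
    { dir := fun h => s h.1 * τ.dir h
      dir_mul_dir := fun e => by
        rw [mul_mul_mul_comm, Int.units_mul_self, one_mul, τ.dir_mul_dir] }
  refine ⟨τ', fun v => ?_⟩
  rw [← hf v, ← boundary_reorient τ τ' f]
  congr 1
  funext e
  have h1 : τ.dir (e, false) * τ'.dir (e, false) = s e := by
    change _ * (s e * _) = _
    rw [mul_left_comm, Int.units_mul_self, mul_one]
  rw [h1]
  have h2 : ∀ x : ZMod 3, x ≠ 0 → 1 = ((if x = 1 then 1 else -1 : ℤˣ) : ℤ) • x := by decide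
  exact h2 _ (hf0 e)

/-- If the constant `1` is a `ℤ₃`-flow under `τ`, then weighting outgoing half-edges by `2` and
incoming ones by `1` is balanced. -/
theorem IsFlow.exists_isBalanced {V E : Type*} [Fintype E] [DecidableEq V] {G : SignedGraph V E}
    {τ : G.Orientation} (h : G.IsFlow τ (fun _ => (1 : ZMod 3))) :
    ∃ n, G.IsBalanced n (fun h => if τ.dir h = 1 then 2 else 1) := by
  have hdvd : ∀ v, 3 ∣ ∑ h, (if G.endOf h = v then (if τ.dir h = 1 then 2 else 1) else 0) := by
    intro v
    -- Modulo 3, `-2 = 1` and `-1 = -1`: the negated weights are the directions, and these sum to 0.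
    rw [← ZMod.natCast_eq_zero_iff, ← neg_eq_zero, ← h v]
    unfold boundary
    rw [Finset.sum_filter, Nat.cast_sum, ← Finset.sum_neg_distrib]
    refine Finset.sum_congr rfl fun h _ => ?_
    split_ifs with h1 h2
    · rw [h2]
      exact (by decide : -((2 : ℕ) : ZMod 3) = ((1 : ℤˣ) : ℤ) • 1)
    · rw [(Int.units_eq_one_or _).resolve_left h2]
      exact (by decide : -((1 : ℕ) : ZMod 3) = ((-1 : ℤˣ) : ℤ) • 1)
    · simp
  choose n hn using hdvd
  refine ⟨n, ⟨fun h => ?_, fun e he => ?_, fun e he => ?_, hn⟩⟩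
  · split_ifs <;> simp
  · rw [τ.dir_true, he]
    rcases Int.units_eq_one_or (τ.dir (e, false)) with h1 | h1 <;> rw [h1] <;> decide
  · rw [τ.dir_true, (Int.units_eq_one_or _).resolve_left he]
    simp

/-- Reversing all edges in a flow. -/
theorem IsIntNZF.neg {V E : Type*} [Fintype E] {G : SignedGraph V E} {τ : G.Orientation} {k : ℕ}
    {f : E → ℤ} (hf : G.IsIntNZF τ k f) : G.IsIntNZF τ k (fun e => - f e) := by
  refine ⟨⟨fun v => ?_, fun e => neg_ne_zero.mpr (hf.1.2 e)⟩, fun e => by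
    rw [abs_neg]; exact hf.2 e⟩
  have := hf.1.1 v
  unfold boundary at this ⊢
  simp only [smul_neg, Finset.sum_neg_distrib, this, neg_zero]

/-- A nowhere-zero `3`-flow with prescribed absolute value at one edge. -/
theorem Bridgeless.exists_isIntNZF_three {V E : Type*} [Fintype V] [Fintype E]
    {G : SignedGraph V E} (hG : G.Bridgeless) (hZ3 : G.AdmitsNZF (ZMod 3)) (e₀ : E) (i : ℤ)
    (hi : i = 1 ∨ i = 2) (τ' : G.Orientation) :
    ∃ f : E → ℤ, G.IsIntNZF τ' 3 f ∧ |f e₀| = i := by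
  classical
  obtain ⟨τ, hτ⟩ := hZ3.exists_isFlow_one
  obtain ⟨n, hb⟩ := hτ.exists_isBalanced
  set b : E × Bool → ℕ := fun h => if τ.dir h = 1 then 2 else 1 with hbdef
  -- As `b` is 1 or 2, the two choices of `k` give `|3 * k - b|` the values 1 and 2 in some order.
  obtain ⟨k, hk, hki⟩ : ∃ k : ℕ, (k = 0 ∨ k = 1) ∧ |(3 * k - b (e₀, false) : ℤ)| = i := by
    rcases hb.one_or_two (e₀, false) with h1 | h1 <;> rcases hi with rfl | rfl <;> rw [h1]
    · exact ⟨0, by decide⟩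
    · exact ⟨1, by decide⟩
    · exact ⟨1, by decide⟩
    · exact ⟨0, by decide⟩
  obtain ⟨c, hc01, hcpos, hcneg, hcsum, hck⟩ := hb.exists_rounding hG e₀ k hk
  -- Defined from one half-edge; the conditions on `b` and `c` give the same value from the other.
  let g : E → ℤ := fun e => (τ.dir (e, false) : ℤ) * (3 * c (e, false) - b (e, false))
  have hg : ∀ h, (τ.dir h : ℤ) • g h.1 = 3 * c h - b h := by
    have hfalse : ∀ e, (τ.dir (e, false) : ℤ) • g e = 3 * c (e, false) - b (e, false) := by
      intro e
      rw [smul_eq_mul, ← mul_assoc, ← Units.val_mul, Int.units_mul_self, Units.val_one, one_mul]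
    rintro ⟨e, d⟩
    cases d
    · exact hfalse e
    · rw [τ.dir_true]
      by_cases he : G.sign e = 1
      · have h1 := hb.add_of_pos e he
        have h2 := hcpos e he
        have h3 := hfalse e
        simp only [he, neg_mul, one_mul, Units.val_neg, neg_smul, h3]
        omega
      · have h1 := hb.eq_of_neg e he
        have h2 := hcneg e he
        have h3 := hfalse e
        rw [(Int.units_eq_one_or _).resolve_left he, neg_neg, one_mul, h3, h1, h2]
  have habs : ∀ (u : ℤˣ) (x : ℤ), |(u : ℤ) * x| = |x| := by
    intro u x
    rcases Int.units_eq_one_or u with rfl | rfl <;> simp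
  have hgabs : ∀ e, |((τ.dir (e, false) * τ'.dir (e, false) : ℤˣ) : ℤ) • g e| =
      |(3 * c (e, false) - b (e, false) : ℤ)| := by
    intro e
    rw [smul_eq_mul, habs, habs]
  refine ⟨fun e => ((τ.dir (e, false) * τ'.dir (e, false) : ℤˣ) : ℤ) • g e,
    ⟨⟨fun v => ?_, fun e => ?_⟩, fun e => ?_⟩, ?_⟩
  · rw [boundary_reorient]
    unfold boundary
    simp_rw [hg]
    have h1 := hb.sum_eq v
    have h2 := hcsum v
    rw [← Finset.sum_filter] at h1 h2
    rw [Finset.sum_sub_distrib, ← Finset.mul_sum, ← Nat.cast_sum, ← Nat.cast_sum]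
    have h3 : ((3 * n v : ℕ) : ℤ) - (3 * n v : ℕ) = 0 := sub_self _
    convert h3 using 2
    · rw [← h2]; push_cast; congr!
    · rw [← h1]
  · rw [← abs_pos, hgabs, abs_pos]
    rcases hb.one_or_two (e, false) with h1 | h1 <;> rw [h1] <;> omega
  · rw [hgabs]
    rcases hb.one_or_two (e, false) with h1 | h1 <;>
      rcases hc01 (e, false) with h2 | h2 <;> rw [h1, h2] <;> norm_num
  · rw [hgabs, hck, hki]

end SignedGraph

theorem mainTheorem6 {V E : Type*} [Fintype V] [Fintype E] (G : SignedGraph V E)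
    (hbridgeless : G.Bridgeless) (hZ3 : G.AdmitsNZF (ZMod 3))
    (e₀ : E) (i : ℤ) (hi : i = 1 ∨ i = 2) :
    ∀ τ : G.Orientation, ∃ f : E → ℤ, G.IsIntNZF τ 3 f ∧ f e₀ = i := by
  intro τ
  obtain ⟨f, hf, hfi⟩ := hbridgeless.exists_isIntNZF_three hZ3 e₀ i hi τ
  rcases abs_choice (f e₀) with h | h
  · exact ⟨f, hf, h.symm.trans hfi⟩
  · exact ⟨fun e => - f e, hf.neg, h.symm.trans hfi⟩
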